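/- For $p\in(0,1)$ let $(X_i)_{i\ge 1}$ be the Markov chain with states $0$ and $1$, transition matrix $$\begin{pmatrix} p_{00} & p_{01}\\ p_{10} & p_{11}\end{pmatrix}=\begin{pmatrix} p & 1-p\\ 1 & 0\end{pmatrix}$$ and initial distribution $(p_0,p_1)=\left(\frac{1}{2-p},\frac{1-p}{2-p}\right)$. For $\beta_0,\beta_1\in(0,1)$ let $\mu_{\beta_0,\beta_1,p}$ be the Borel probability measure on $\mathbb{R}$ that is the distribution of the random series $$S=\sum_{i=1}^{\infty}X_i\,\beta_1^{\hat X_i}\,\beta_0^{\,i-\hat X_i},\qquad \hat X_i=\sum_{k=1}^{i}X_k .$$ **Corollary.** Let $p\in(0,1)$ and $c\in(0,1]$. For Lebesgue-almost every $\beta\in(0,0.739)$ with $$\left(\frac{p}{\beta}\right)^{p}\left(\frac{1-p}{c\beta^{2}}\right)^{1-p}<1,$$ the measure $\mu_{\beta,c\beta,p}$ is absolutely continuous with respect to Lebesgue measure on $\mathbb{R}$. -/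

import Mathlib

open MeasureTheory ProbabilityTheory

namespace MarkovGeometric

noncomputable section

/-- The transition matrix of the chain with states `0` and `1`. -/
def transitionMatrix (p : ℝ) : Matrix (Fin 2) (Fin 2) ℝ :=
  !![p, 1 - p; 1, 0]

/-- The initial distribution of the chain. -/
def initialVector (p : ℝ) : Fin 2 → ℝ :=
  ![1 / (2 - p), (1 - p) / (2 - p)]

/-- The measure on the two states with point masses `w 0` and `w 1`. -/
def stateMeasure (w : Fin 2 → ℝ) : Measure (Fin 2) :=
  ∑ j, ENNReal.ofReal (w j) • Measure.dirac j

theorem isProbabilityMeasure_stateMeasure {w : Fin 2 → ℝ} (hw : w ∈ stdSimplex ℝ (Fin 2)) :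
    IsProbabilityMeasure (stateMeasure w) := by
  constructor
  have h : ∑ j, ENNReal.ofReal (w j) = 1 := by
    rw [← ENNReal.ofReal_sum_of_nonneg fun j _ => hw.1 j, hw.2, ENNReal.ofReal_one]
  simpa [stateMeasure] using h

theorem transitionMatrix_mem (p : Set.Ioo (0 : ℝ) 1) (i : Fin 2) :
    transitionMatrix p i ∈ stdSimplex ℝ (Fin 2) := by
  obtain ⟨p, h0, h1⟩ := p
  refine ⟨fun j => ?_, ?_⟩
  · fin_cases i <;> fin_cases j <;> simp [transitionMatrix] <;> linarith
  · fin_cases i <;> simp [transitionMatrix]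

theorem initialVector_mem (p : Set.Ioo (0 : ℝ) 1) :
    initialVector p ∈ stdSimplex ℝ (Fin 2) := by
  obtain ⟨p, h0, h1⟩ := p
  have h2 : 0 < 2 - p := by linarith
  refine ⟨fun j => ?_, ?_⟩
  · fin_cases j
    · simpa [initialVector] using h2.le
    · simpa [initialVector] using div_nonneg (by linarith : 0 ≤ 1 - p) h2.le
  · simp only [initialVector, Fin.sum_univ_two, Matrix.cons_val_zero, Matrix.cons_val_one]
    field_simp
    ring

instance (p : Set.Ioo (0 : ℝ) 1) : IsProbabilityMeasure (stateMeasure (initialVector p)) :=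
  isProbabilityMeasure_stateMeasure (initialVector_mem p)

/-- The step of the chain: given the states at the times `0, …, n`, the next state is distributed
according to the row of the transition matrix indexed by the state at time `n`. -/
def stepKernel (p : Set.Ioo (0 : ℝ) 1) (n : ℕ) :
    Kernel (Finset.Iic n → Fin 2) (Fin 2) where
  toFun x := stateMeasure (transitionMatrix p (x ⟨n, Finset.mem_Iic.2 le_rfl⟩))
  measurable' := measurable_of_finite _

instance (p : Set.Ioo (0 : ℝ) 1) (n : ℕ) : IsMarkovKernel (stepKernel p n) :=
  ⟨fun _ => isProbabilityMeasure_stateMeasure (transitionMatrix_mem p _)⟩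

/-- The law `ν_p` on `{0,1}^ℕ` of the Markov chain with initial distribution `initialVector p` and
transition matrix `transitionMatrix p`. The coordinate `x n` is the state `X_{n+1}` of the chain
`(X_1, X_2, …)`. -/
def chainLaw (p : Set.Ioo (0 : ℝ) 1) : Measure (ℕ → Fin 2) :=
  Kernel.trajMeasure (X := fun _ => Fin 2) (stateMeasure (initialVector p)) (stepKernel p)

instance (p : Set.Ioo (0 : ℝ) 1) : IsProbabilityMeasure (chainLaw p) :=
  inferInstanceAs (IsProbabilityMeasure (Kernel.trajMeasure (X := fun _ => Fin 2)
    (stateMeasure (initialVector p)) (stepKernel p)))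

/-- The number of ones among the first `i` entries `X_1, …, X_i`. -/
def countOnes (x : ℕ → Fin 2) (i : ℕ) : ℕ :=
  ∑ k ∈ Finset.range i, (x k : ℕ)

theorem countOnes_le (x : ℕ → Fin 2) (i : ℕ) : countOnes x i ≤ i := by
  calc countOnes x i ≤ ∑ _k ∈ Finset.range i, 1 :=
        Finset.sum_le_sum fun k _ => by have := (x k).isLt; omega
    _ = i := by simp

/-- The random series `S = ∑_{i ≥ 1} X_i β₁^{N_i} β₀^{i - N_i}`, where `N_i` is the number of ones
among `X_1, …, X_i` (summation index `n = i - 1`). -/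
def series (β₀ β₁ : ℝ) (x : ℕ → Fin 2) : ℝ :=
  ∑' n : ℕ, ((x n : ℕ) : ℝ) * β₁ ^ countOnes x (n + 1) * β₀ ^ (n + 1 - countOnes x (n + 1))

/-- The series converges for all parameters in `(0,1)`. -/
theorem summable_series {β₀ β₁ : ℝ} (h₀ : β₀ ∈ Set.Ioo (0 : ℝ) 1) (h₁ : β₁ ∈ Set.Ioo (0 : ℝ) 1)
    (x : ℕ → Fin 2) :
    Summable fun n : ℕ =>
      ((x n : ℕ) : ℝ) * β₁ ^ countOnes x (n + 1) * β₀ ^ (n + 1 - countOnes x (n + 1)) := by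
  have hm : max β₀ β₁ < 1 := max_lt h₀.2 h₁.2
  have hm0 : 0 ≤ max β₀ β₁ := h₀.1.le.trans (le_max_left _ _)
  have hs : Summable fun n : ℕ => (max β₀ β₁) ^ (n + 1) :=
    (summable_nat_add_iff 1).2 (summable_geometric_of_lt_one hm0 hm)
  have p0 := h₀.1.le
  have p1 := h₁.1.le
  refine Summable.of_nonneg_of_le (fun n => by positivity) (fun n => ?_) hs
  have hx : ((x n : ℕ) : ℝ) ≤ 1 := by
    have := (x n).isLt
    exact_mod_cast (by omega : (x n : ℕ) ≤ 1)
  calc ((x n : ℕ) : ℝ) * β₁ ^ countOnes x (n + 1) * β₀ ^ (n + 1 - countOnes x (n + 1))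
      ≤ 1 * (max β₀ β₁) ^ countOnes x (n + 1) * (max β₀ β₁) ^ (n + 1 - countOnes x (n + 1)) := by
        gcongr
        · exact le_max_right _ _
        · exact le_max_left _ _
    _ = (max β₀ β₁) ^ (n + 1) := by
        rw [one_mul, ← pow_add, Nat.add_sub_cancel' (countOnes_le x (n + 1))]

theorem measurable_series (β₀ β₁ : ℝ) : Measurable (series β₀ β₁) := by
  have hc : ∀ i, Measurable fun x : ℕ → Fin 2 => countOnes x i := fun i =>
    Finset.measurable_sum _ fun k _ => (measurable_of_finite _).comp (measurable_pi_apply k)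
  refine Measurable.tsum fun n => ?_
  refine Measurable.mul (Measurable.mul ?_ ?_) ?_
  · exact (measurable_of_finite fun j : Fin 2 => ((j : ℕ) : ℝ)).comp (measurable_pi_apply n)
  · exact (measurable_from_nat (f := fun m => β₁ ^ m)).comp (hc (n + 1))
  · exact (measurable_from_nat (f := fun m => β₀ ^ (n + 1 - m))).comp (hc (n + 1))

/-- The nonuniform Markov geometric measure `μ_{β₀,β₁,p}`: the distribution of the random series. -/
def markovGeometricMeasure (β₀ β₁ : ℝ) (p : Set.Ioo (0 : ℝ) 1) : Measure ℝ :=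
  (chainLaw p).map (series β₀ β₁)

instance (β₀ β₁ : ℝ) (p : Set.Ioo (0 : ℝ) 1) :
    IsProbabilityMeasure (markovGeometricMeasure β₀ β₁ p) :=
  Measure.isProbabilityMeasure_map (measurable_series β₀ β₁).aemeasurable

end

end MarkovGeometric

/-! The proof is the transversality method combined with differentiation of measures. Since p₁₁ = 0,
almost no path has adjacent ones. If two such paths first differ at index n, their series differ by
c^(N+1) β^(n+1) f(β), where N counts the ones before n and f = ∑ (uᵢ - wᵢ) xⁱ with u₀ = 1, w₀ = 0
and u, w sparse. Multiplied by x⁻⁵, f decreases on (0, 0.739] at rate at least 0.004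
(`sparseSum_sub_ge`), so |f| ≤ ρ holds only on a set of diameter O(ρ) (`volume_sparse_sub_le`).

Fix s > 0 and a path x. By Fubini, the mass of the ball of radius r about S(x), integrated over β in
[s, 0.739], is at most a constant times r ∑ₙ P(agreement with x before n) / (c^(N+1) s^(n+1))
(`exists_lintegral_close_le`). The terms are controlled by the product Rₙ of the one-step ratios of
probability to contraction. Between visits to state 0 the chain either stays (probability p,
contraction s) or goes 0 → 1 → 0 (probability 1 - p, contraction c s²). The hypothesis at s says
that the mean logarithm of the ratio over such an excursion is negative. Hence some small moment of
Rₙ decays geometrically and ∑ Rₙ < ∞ almost surely (`ae_summable_pathRatio`).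

Fatou's lemma then gives a finite lower density at almost every point for almost every β, which
forces absolute continuity. Countably many rational s cover all admissible β. -/

namespace MarkovGeometric

/-! ### Transversality for sparse power series -/

/-- A sequence in `[0,∞)` such that any two consecutive terms sum to at most one. -/
structure IsSparse (u : ℕ → ℝ) : Prop where
  nonneg : ∀ i, 0 ≤ u i
  add_le : ∀ i, u i + u (i + 1) ≤ 1

theorem IsSparse.le_one {u : ℕ → ℝ} (hu : IsSparse u) (i : ℕ) : u i ≤ 1 := by
  linarith [hu.add_le i, hu.nonneg (i + 1)]

theorem sum_sub_five_mul_pow_tail_le {x : ℝ} (hx : x < 1) (n : ℕ) (h0 : 0 ≤ x) :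
    ∑ i ∈ Finset.range n, ((i : ℝ) + 25) * x ^ (i + 30) ≤
      x ^ 30 * (25 / (1 - x) + x / (1 - x) ^ 2) := by
  have h1 : 0 < 1 - x := by linarith
  have key : ∀ n : ℕ, ∑ i ∈ Finset.range n, ((i : ℝ) + 25) * x ^ (i + 30) =
      x ^ 30 * (25 / (1 - x) + x / (1 - x) ^ 2) -
        x ^ (n + 30) * ((n + 25) / (1 - x) + x / (1 - x) ^ 2) := by
    intro n
    induction n with
    | zero => simp
    | succ n ih =>
      rw [Finset.sum_range_succ, ih]
      push_cast
      field_simp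
      ring
  rw [key]
  have : 0 ≤ x ^ (n + 30) * ((n + 25) / (1 - x) + x / (1 - x) ^ 2) := by positivity
  linarith

/-- Every term increases with x, so the worst case is x = 0.739. What remains is a linear program in
u 6, …, u 29 under the sparsity constraints, for which `linarith` finds a dual certificate. -/
theorem sum_weighted_sparse_head_le {u : ℕ → ℝ} (hu : IsSparse u) {x : ℝ} (h0 : 0 ≤ x)
    (hx : x ≤ 0.739) :
    ∑ i ∈ Finset.range 24, ((i : ℝ) + 1) * u (i + 6) * x ^ (i + 6) ≤ 1.22 := by
  have hb : ∑ i ∈ Finset.range 24, ((i : ℝ) + 1) * u (i + 6) * x ^ (i + 6) ≤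
      ∑ i ∈ Finset.range 24, ((i : ℝ) + 1) * u (i + 6) * 0.739 ^ (i + 6) := by
    refine Finset.sum_le_sum fun i _ => ?_
    have := hu.nonneg (i + 6)
    gcongr
  refine hb.trans ?_
  simp only [Finset.sum_range_succ, Finset.sum_range_zero]
  norm_num only [Nat.cast_ofNat, Nat.cast_zero, Nat.cast_one]
  have hn := fun i => hu.nonneg i
  have ha := fun i => hu.add_le i
  linarith [ha 6, ha 7, ha 8, ha 9, ha 10, ha 11, ha 12, ha 13, ha 14, ha 15, ha 16, ha 17, ha
    18, ha 19, ha 20, ha 21, ha 22, ha 23, ha 24, ha 25, ha 26, ha 27, ha 28, hn 6, hn 7, hn 8, hn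
    9, hn 10, hn 11, hn 12, hn 13, hn 14, hn 15, hn 16, hn 17, hn 18, hn 19, hn 20, hn 21, hn 22,
    hn 23, hn 24, hn 25, hn 26, hn 27, hn 28, hn 29]

/-- Up to the factor x⁻⁶ this is the derivative of x⁻⁵ ∑ (uᵢ - wᵢ) xⁱ. The shift by 5 turns u 0 = 1
into the gain -5, against which only u at indices above 5 and w at indices below 5 count. At x =
0.739 the losses 1.22 + 0.0124 + 4x + 2x³ stay just below 4.996. -/
theorem sum_weighted_sparse_sub_le {u w : ℕ → ℝ} (hu : IsSparse u) (hw : IsSparse w)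
    (hu0 : u 0 = 1) (hw0 : w 0 = 0) {x : ℝ} (h0 : 0 ≤ x) (hx : x ≤ 0.739) (n : ℕ) :
    ∑ i ∈ Finset.range (n + 30), ((i : ℝ) - 5) * (u i - w i) * x ^ i ≤ -0.004 := by
  have hu1 : u 1 = 0 := le_antisymm (by linarith [hu.add_le 0]) (hu.nonneg 1)
  have hsplit : ∑ i ∈ Finset.range (n + 30), ((i : ℝ) - 5) * (u i - w i) * x ^ i =
      ∑ i ∈ Finset.range (n + 30), ((i : ℝ) - 5) * u i * x ^ i +
        ∑ i ∈ Finset.range (n + 30), (5 - (i : ℝ)) * w i * x ^ i := by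
    rw [← Finset.sum_add_distrib]
    exact Finset.sum_congr rfl fun i _ => by ring
  have hwle : ∑ i ∈ Finset.range (n + 30), (5 - (i : ℝ)) * w i * x ^ i ≤ 4 * x + 2 * x ^ 3 := by
    rw [show n + 30 = 5 + (n + 25) by ring, Finset.sum_range_add]
    have h1 : ∑ i ∈ Finset.range (n + 25), (5 - ((5 + i : ℕ) : ℝ)) * w (5 + i) * x ^ (5 + i) ≤ 0 := by
      refine Finset.sum_nonpos fun i _ => ?_
      push_cast
      have := mul_nonneg (mul_nonneg (Nat.cast_nonneg (α := ℝ) i) (hw.nonneg (5 + i)))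
        (pow_nonneg h0 (5 + i))
      linarith
    have h2 : ∑ i ∈ Finset.range 5, (5 - (i : ℝ)) * w i * x ^ i ≤ 4 * x + 2 * x ^ 3 := by
      simp only [Finset.sum_range_succ, Finset.sum_range_zero, hw0]
      push_cast
      -- The weight of w 2 is raised to that of w 1 so that w 1 + w 2 ≤ 1 applies; the pair w 3, w 4
      -- is treated in the same way.
      have e1 : 3 * w 2 * x ^ 2 ≤ 4 * x * w 2 := by
        nlinarith [mul_nonneg (mul_nonneg (hw.nonneg 2) h0) (by linarith : (0 : ℝ) ≤ 4 - 3 * x)]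
      have e2 : w 4 * x ^ 4 ≤ 2 * x ^ 3 * w 4 := by
        nlinarith [mul_nonneg (mul_nonneg (hw.nonneg 4) (pow_nonneg h0 3))
          (by linarith : (0 : ℝ) ≤ 2 - x)]
      have e3 : 4 * x * (w 1 + w 2) ≤ 4 * x * 1 := by gcongr; exact hw.add_le 1
      have e4 : 2 * x ^ 3 * (w 3 + w 4) ≤ 2 * x ^ 3 * 1 := by gcongr; exact hw.add_le 3
      linarith
    linarith
  have hule : ∑ i ∈ Finset.range (n + 30), ((i : ℝ) - 5) * u i * x ^ i ≤ -5 + 1.22 + 0.0124 := by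
    rw [show n + 30 = 6 + 24 + n by ring, Finset.sum_range_add, Finset.sum_range_add]
    have h1 : ∑ i ∈ Finset.range 6, ((i : ℝ) - 5) * u i * x ^ i ≤ -5 := by
      simp only [Finset.sum_range_succ, Finset.sum_range_zero, hu0, hu1]
      push_cast
      linarith [mul_nonneg (hu.nonneg 2) (pow_nonneg h0 2), mul_nonneg (hu.nonneg 3) (pow_nonneg h0 3),
        mul_nonneg (hu.nonneg 4) (pow_nonneg h0 4)]
    have h2 : ∑ i ∈ Finset.range 24, (((6 + i : ℕ) : ℝ) - 5) * u (6 + i) * x ^ (6 + i) ≤ 1.22 := by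
      refine le_of_eq_of_le (Finset.sum_congr rfl fun i _ => ?_)
        (sum_weighted_sparse_head_le hu h0 hx)
      rw [add_comm 6 i]
      push_cast
      ring
    have h3 : ∑ i ∈ Finset.range n, (((6 + 24 + i : ℕ) : ℝ) - 5) * u (6 + 24 + i) *
        x ^ (6 + 24 + i) ≤ 0.0124 := by
      calc _ ≤ ∑ i ∈ Finset.range n, ((i : ℝ) + 25) * 0.739 ^ (i + 30) := by
            refine Finset.sum_le_sum fun i _ => ?_
            rw [show 6 + 24 + i = i + 30 by ring]
            push_cast
            have e : (i : ℝ) + 30 - 5 = i + 25 := by ring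
            have := hu.nonneg (i + 30)
            rw [e]
            calc ((i : ℝ) + 25) * u (i + 30) * x ^ (i + 30)
                ≤ ((i : ℝ) + 25) * 1 * 0.739 ^ (i + 30) := by
                  gcongr
                  exact hu.le_one _
              _ = _ := by ring
        _ ≤ _ := sum_sub_five_mul_pow_tail_le (by norm_num) n (by norm_num)
        _ ≤ _ := by norm_num
    linarith
  have hx3 : x ^ 3 ≤ 0.739 ^ 3 := pow_le_pow_left₀ h0 hx 3
  norm_num at hx3
  linarith

/-- The partial sums of `x⁻⁵ ∑ (uᵢ - wᵢ) xⁱ`. -/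
noncomputable def sparseSum (u w : ℕ → ℝ) (n : ℕ) (x : ℝ) : ℝ :=
  ∑ i ∈ Finset.range n, (u i - w i) * x ^ ((i : ℤ) - 5)

theorem sparseSum_sub_ge {u w : ℕ → ℝ} (hu : IsSparse u) (hw : IsSparse w)
    (hu0 : u 0 = 1) (hw0 : w 0 = 0) {a b : ℝ} (ha : 0 < a) (hab : a ≤ b) (hb : b ≤ 0.739) (n : ℕ) :
    0.004 * (b - a) ≤ sparseSum u w (n + 30) a - sparseSum u w (n + 30) b := by
  have hd : ∀ x ∈ Set.Icc a b, HasDerivAt (sparseSum u w (n + 30))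
      (∑ i ∈ Finset.range (n + 30), (u i - w i) *
        ((((i : ℤ) - 5 : ℤ) : ℝ) * x ^ ((i : ℤ) - 5 - 1))) x := by
    intro x hx
    have hx0 : x ≠ 0 := (ha.trans_le hx.1).ne'
    have := HasDerivAt.fun_sum (u := Finset.range (n + 30)) fun i _ =>
      (hasDerivAt_zpow ((i : ℤ) - 5) x (Or.inl hx0)).const_mul (u i - w i)
    exact this
  have hle : ∀ x ∈ Set.Icc a b, (∑ i ∈ Finset.range (n + 30), (u i - w i) *
        ((((i : ℤ) - 5 : ℤ) : ℝ) * x ^ ((i : ℤ) - 5 - 1))) ≤ -0.004 := by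
    intro x hx
    have hx0 : 0 < x := ha.trans_le hx.1
    have h1 := sum_weighted_sparse_sub_le hu hw hu0 hw0 hx0.le (hx.2.trans hb) n
    have h2 : (∑ i ∈ Finset.range (n + 30), (u i - w i) *
        ((((i : ℤ) - 5 : ℤ) : ℝ) * x ^ ((i : ℤ) - 5 - 1))) = (x ^ 6)⁻¹ *
        ∑ i ∈ Finset.range (n + 30), ((i : ℝ) - 5) * (u i - w i) * x ^ i := by
      rw [Finset.mul_sum]
      refine Finset.sum_congr rfl fun i _ => ?_
      rw [show (i : ℤ) - 5 - 1 = (i : ℤ) - 6 by ring, zpow_sub₀ hx0.ne', zpow_natCast]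
      push_cast
      rw [div_eq_mul_inv, show x ^ (6 : ℤ) = x ^ 6 from by norm_cast]
      ring
    rw [h2]
    -- A factor of at least 1 only makes the negative bound more negative.
    have h3 : 1 ≤ (x ^ 6)⁻¹ := (one_le_inv₀ (by positivity)).2
      (pow_le_one₀ hx0.le (by linarith [hx.2]))
    nlinarith
  have hc : ContinuousOn (sparseSum u w (n + 30)) (Set.Icc a b) :=
    fun x hx => (hd x hx).continuousAt.continuousWithinAt
  have := (convex_Icc a b).image_sub_le_mul_sub_of_deriv_le hc
    (fun x hx => (hd x (interior_subset hx)).differentiableAt.differentiableWithinAt)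
    (C := -0.004) (fun x hx => by
      rw [(hd x (interior_subset hx)).deriv]
      exact hle x (interior_subset hx)) a (Set.left_mem_Icc.2 hab) b (Set.right_mem_Icc.2 hab) hab
  linarith

theorem summable_sparse_sub {u w : ℕ → ℝ} (hu : IsSparse u) (hw : IsSparse w) {x : ℝ}
    (h0 : 0 ≤ x) (h1 : x < 1) : Summable fun i => (u i - w i) * x ^ i := by
  refine Summable.of_norm_bounded (summable_geometric_of_lt_one h0 h1) fun i => ?_
  rw [Real.norm_eq_abs, abs_mul, abs_of_nonneg (pow_nonneg h0 i)]
  refine mul_le_of_le_one_left (pow_nonneg h0 i) (abs_le.2 ⟨?_, ?_⟩) <;>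
    linarith [hu.nonneg i, hw.nonneg i, hu.le_one i, hw.le_one i]

theorem tendsto_sparseSum {u w : ℕ → ℝ} (hu : IsSparse u) (hw : IsSparse w) {x : ℝ}
    (h0 : 0 < x) (h1 : x < 1) :
    Filter.Tendsto (fun n => sparseSum u w (n + 30) x) Filter.atTop
      (nhds ((x ^ 5)⁻¹ * ∑' i, (u i - w i) * x ^ i)) := by
  have := (((summable_sparse_sub hu hw h0.le h1).hasSum.tendsto_sum_nat).const_mul
    (x ^ 5)⁻¹).comp (Filter.tendsto_add_atTop_nat 30)
  refine this.congr fun n => ?_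
  simp only [Function.comp, sparseSum, Finset.mul_sum]
  refine Finset.sum_congr rfl fun i _ => ?_
  rw [zpow_sub₀ h0.ne', zpow_natCast, show x ^ (5 : ℤ) = x ^ 5 from by norm_cast]
  ring

/-- Transversality: the differences of two sparse power series are small only on a short set. -/
theorem volume_sparse_sub_le {u w : ℕ → ℝ} (hu : IsSparse u) (hw : IsSparse w)
    (hu0 : u 0 = 1) (hw0 : w 0 = 0) {s : ℝ} (hs : 0 < s) (ρ : ℝ) :
    volume {x ∈ Set.Icc s 0.739 | |∑' i, (u i - w i) * x ^ i| ≤ ρ} ≤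
      ENNReal.ofReal (500 * (s ^ 5)⁻¹ * ρ) := by
  -- For a ≤ b in the set, 0.004 (b - a) ≤ 2 s⁻⁵ ρ, which gives the constant 500 = 2 / 0.004.
  refine (Real.volume_le_diam _).trans (Metric.ediam_le_of_forall_dist_le fun a ha b hb => ?_)
  wlog hab : a ≤ b generalizing a b
  · rw [dist_comm]
    exact this b hb a ha (le_of_not_ge hab)
  obtain ⟨⟨ha1, ha2⟩, ha3⟩ := ha
  obtain ⟨⟨hb1, hb2⟩, hb3⟩ := hb
  have ha0 : 0 < a := hs.trans_le ha1
  have hb0 : 0 < b := hs.trans_le hb1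
  have key : 0.004 * (b - a) ≤ (a ^ 5)⁻¹ * (∑' i, (u i - w i) * a ^ i) -
      (b ^ 5)⁻¹ * ∑' i, (u i - w i) * b ^ i :=
    ge_of_tendsto' ((tendsto_sparseSum hu hw ha0 (by linarith)).sub
      (tendsto_sparseSum hu hw hb0 (by linarith)))
      fun n => sparseSum_sub_ge hu hw hu0 hw0 ha0 hab hb2 n
  have hpow : ∀ y, s ≤ y → |∑' i, (u i - w i) * y ^ i| ≤ ρ →
      |(y ^ 5)⁻¹ * ∑' i, (u i - w i) * y ^ i| ≤ (s ^ 5)⁻¹ * ρ := by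
    intro y hy h
    have hy0 : 0 < y := hs.trans_le hy
    rw [abs_mul, abs_of_pos (by positivity)]
    gcongr
  have h1 := (abs_le.1 (hpow a ha1 ha3)).2
  have h2 := (abs_le.1 (hpow b hb1 hb3)).1
  rw [dist_comm, Real.dist_eq, abs_of_nonneg (by linarith)]
  linarith

/-! ### Markov property and cylinder probabilities -/

/-- The transfer of the one-step law: integrating over the next state. -/
theorem lintegral_chainLaw_succ (p : Set.Ioo (0 : ℝ) 1) (n : ℕ)
    (H : (ℕ → Fin 2) → Fin 2 → ENNReal)
    (hH : ∀ x y, (∀ i ≤ n, x i = y i) → H x = H y) :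
    ∫⁻ x, H x (x (n + 1)) ∂chainLaw p =
      ∫⁻ x, ∑ j, ENNReal.ofReal (transitionMatrix p (x n) j) * H x j ∂chainLaw p := by
  classical
  let ext : (Finset.Iic n → Fin 2) → ℕ → Fin 2 :=
    fun z i => if h : i ∈ Finset.Iic n then z ⟨i, h⟩ else 0
  have hext : ∀ x : ℕ → Fin 2, H (ext (Preorder.frestrictLe (π := fun _ => Fin 2) n x)) = H x := by
    intro x
    refine hH _ _ fun i hi => ?_
    simp [ext, hi]
  have hmeas : ∀ {β : Type} [MeasurableSpace β] [Finite β] [MeasurableSingletonClass β]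
    (f : β → ENNReal), Measurable f := fun f => measurable_of_finite f
  have hr : Measurable (Preorder.frestrictLe (π := fun _ => Fin 2) n) :=
    Preorder.measurable_frestrictLe n
  have key : (chainLaw p).map (Preorder.frestrictLe (π := fun _ => Fin 2) n) ⊗ₘ stepKernel p n =
      (chainLaw p).map (fun x => (Preorder.frestrictLe (π := fun _ => Fin 2) n x, x (n + 1))) :=
    Kernel.map_frestrictLe_trajMeasure_compProd_eq_map_trajMeasure
  let F : (Finset.Iic n → Fin 2) × Fin 2 → ENNReal := fun z => H (ext z.1) z.2
  have h1 : ∫⁻ x, H x (x (n + 1)) ∂chainLaw p = ∫⁻ z, F z ∂((chainLaw p).map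
      (fun x => (Preorder.frestrictLe (π := fun _ => Fin 2) n x, x (n + 1)))) := by
    rw [lintegral_map (hmeas F) (hr.prodMk (measurable_pi_apply _))]
    simp only [F, hext]
  rw [h1, ← key, Measure.lintegral_compProd (hmeas F), lintegral_map (hmeas _) hr]
  refine lintegral_congr fun x => ?_
  have h2 : stepKernel p n (Preorder.frestrictLe (π := fun _ => Fin 2) n x) =
      stateMeasure (transitionMatrix p (x n)) := rfl
  rw [h2, stateMeasure, lintegral_finsetSum_measure]
  simp only [lintegral_smul_measure, lintegral_dirac, F, hext, smul_eq_mul]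

/-- The probability of a path, given its initial state. -/
noncomputable def pathProb (p : ℝ) (x : ℕ → Fin 2) (n : ℕ) : ℝ :=
  ∏ i ∈ Finset.range n, transitionMatrix p (x i) (x (i + 1))

theorem transitionMatrix_nonneg (p : Set.Ioo (0 : ℝ) 1) (i j : Fin 2) :
    0 ≤ transitionMatrix p i j :=
  (transitionMatrix_mem p i).1 j

/-- The probability of the initial state is bounded by one; each further coordinate contributes a
transition probability. -/
theorem chainLaw_cylinder_le (p : Set.Ioo (0 : ℝ) 1) (x : ℕ → Fin 2) (n : ℕ) :
    chainLaw p {y | ∀ i ≤ n, y i = x i} ≤ ENNReal.ofReal (pathProb p x n) := by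
  classical
  have hms : ∀ n, MeasurableSet {y : ℕ → Fin 2 | ∀ i ≤ n, y i = x i} := fun n => by
    have : {y : ℕ → Fin 2 | ∀ i ≤ n, y i = x i} = ⋂ i ∈ Set.Iic n, {y | y i = x i} := by
      ext; simp
    rw [this]
    exact MeasurableSet.biInter (Set.to_countable _) fun i _ =>
      measurableSet_eq_fun (measurable_pi_apply i) measurable_const
  induction n with
  | zero => simpa [pathProb] using prob_le_one
  | succ n ih =>
    let H : (ℕ → Fin 2) → Fin 2 → ENNReal := fun y j =>
      if (∀ i ≤ n, y i = x i) ∧ j = x (n + 1) then 1 else 0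
    have h1 : chainLaw p {y | ∀ i ≤ n + 1, y i = x i} = ∫⁻ y, H y (y (n + 1)) ∂chainLaw p := by
      rw [← lintegral_indicator_one (hms (n + 1))]
      refine lintegral_congr fun y => ?_
      simp only [Set.indicator_apply, H, Set.mem_ofPred_eq, Pi.one_apply]
      congr 1
      simp only [Nat.le_succ_iff, eq_iff_iff]
      constructor
      · exact fun h => ⟨fun i hi => h i (Or.inl hi), h _ (Or.inr rfl)⟩
      · rintro ⟨h, h'⟩ i (hi | rfl)
        exacts [h i hi, h']
    rw [h1, lintegral_chainLaw_succ p n H]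
    · have h2 : ∀ y, ∑ j, ENNReal.ofReal (transitionMatrix p (y n) j) * H y j =
          ENNReal.ofReal (transitionMatrix p (x n) (x (n + 1))) *
            {y : ℕ → Fin 2 | ∀ i ≤ n, y i = x i}.indicator 1 y := by
        intro y
        by_cases hy : ∀ i ≤ n, y i = x i
        · rw [Set.indicator_of_mem (show y ∈ {y : ℕ → Fin 2 | ∀ i ≤ n, y i = x i} from hy)]
          rw [Finset.sum_eq_single (x (n + 1)) (fun j _ hj => by simp [H, hj]) (by simp)]
          simp only [H]
          rw [if_pos ⟨hy, trivial⟩, hy n le_rfl, Pi.one_apply]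
        · rw [Set.indicator_of_notMem (show y ∉ {y : ℕ → Fin 2 | ∀ i ≤ n, y i = x i} from hy)]
          simp [H, hy]
      simp_rw [h2]
      rw [lintegral_const_mul' _ _ ENNReal.ofReal_ne_top, lintegral_indicator_one (hms n),
        pathProb, Finset.prod_range_succ, mul_comm,
        ENNReal.ofReal_mul (Finset.prod_nonneg fun i _ => transitionMatrix_nonneg p _ _)]
      gcongr
      exact ih
    · intro y z h
      ext j
      have : (∀ i ≤ n, y i = x i) ↔ ∀ i ≤ n, z i = x i :=
        forall₂_congr fun i hi => by rw [h i hi]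
      simp only [H, this]

theorem measurable_two_coordinates {β : Type*} [MeasurableSpace β] (F : Fin 2 → Fin 2 → β)
    (m n : ℕ) : Measurable fun x : ℕ → Fin 2 => F (x m) (x n) := by
  have h1 : Measurable fun z : Fin 2 × Fin 2 => F z.1 z.2 := measurable_of_finite _
  have h2 : Measurable fun x : ℕ → Fin 2 => (x m, x n) :=
    (measurable_pi_apply m).prodMk (measurable_pi_apply n)
  exact h1.comp h2

theorem ae_chainLaw_not_adjacent_ones (p : Set.Ioo (0 : ℝ) 1) :
    ∀ᵐ x ∂chainLaw p, ∀ n, ¬ (x n = 1 ∧ x (n + 1) = 1) := by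
  classical
  rw [ae_all_iff]
  intro n
  let H : (ℕ → Fin 2) → Fin 2 → ENNReal := fun y j => if y n = 1 ∧ j = 1 then 1 else 0
  have hi : ∫⁻ x, H x (x (n + 1)) ∂chainLaw p = 0 := by
    rw [lintegral_chainLaw_succ p n H fun x y h => by ext j; simp [H, h n le_rfl]]
    refine (lintegral_congr fun x => ?_).trans lintegral_zero
    refine Finset.sum_eq_zero fun j _ => ?_
    by_cases h : x n = 1 ∧ j = 1
    · simp [h.1, h.2, transitionMatrix]
    · simp [H, h]
  have hm : Measurable fun x : ℕ → Fin 2 => H x (x (n + 1)) :=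
    measurable_two_coordinates (fun i j => if i = 1 ∧ j = 1 then (1 : ENNReal) else 0) n (n + 1)
  filter_upwards [(lintegral_eq_zero_iff hm).1 hi] with x hx h
  simp [H, h.1, h.2] at hx

/-! ### Almost sure summability of the probability-to-contraction ratios -/

/-- The ratio of the one-step probability and the one-step contraction. -/
noncomputable def stepRatio (p c s : ℝ) (i j : Fin 2) : ℝ :=
  transitionMatrix p i j / (c ^ (j : ℕ) * s)

theorem stepRatio_nonneg (p : Set.Ioo (0 : ℝ) 1) {c s : ℝ} (hc : 0 < c) (hs : 0 < s)
    (i j : Fin 2) : 0 ≤ stepRatio p c s i j :=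
  div_nonneg (transitionMatrix_nonneg p i j) (by positivity)

/-- The ratio of the probability and the contraction along a path. -/
noncomputable def pathRatio (p c s : ℝ) (x : ℕ → Fin 2) (n : ℕ) : ℝ :=
  ∏ i ∈ Finset.range n, stepRatio p c s (x i) (x (i + 1))

/-- As a function of θ the left side equals 1 at θ = 0, and its derivative there is the logarithm of
the product in the hypothesis, hence negative. -/
theorem exists_rpow_mean_lt_one {p c s : ℝ} (hp : p ∈ Set.Ioo (0 : ℝ) 1) (hc : 0 < c) (hs : 0 < s)
    (h : (p / s) ^ p * ((1 - p) / (c * s ^ 2)) ^ (1 - p) < 1) :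
    ∃ θ ∈ Set.Ioc (0 : ℝ) 1,
      p * (p / s) ^ θ + (1 - p) * ((1 - p) / (c * s ^ 2)) ^ θ < 1 := by
  obtain ⟨hp0, hp1⟩ := hp
  have hq : 0 < 1 - p := by linarith
  set a := p / s with ha
  set b := (1 - p) / (c * s ^ 2) with hb
  have ha0 : 0 < a := by positivity
  have hb0 : 0 < b := by positivity
  have hlog : p * Real.log a + (1 - p) * Real.log b < 0 := by
    have := Real.log_neg (by positivity) h
    rwa [Real.log_mul (by positivity) (by positivity), Real.log_rpow ha0, Real.log_rpow hb0] at this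
  have hd : HasDerivAt (fun θ : ℝ => p * a ^ θ + (1 - p) * b ^ θ)
      (p * Real.log a + (1 - p) * Real.log b) 0 := by
    have h1 := ((Real.hasStrictDerivAt_const_rpow ha0 0).hasDerivAt.const_mul p).fun_add
      ((Real.hasStrictDerivAt_const_rpow hb0 0).hasDerivAt.const_mul (1 - p))
    simpa using h1
  have h1 := (hasDerivAt_iff_tendsto_slope.1 hd).eventually_lt_const hlog
  have h2 := (h1.filter_mono (nhdsWithin_mono _
    (show Set.Ioi (0 : ℝ) ⊆ {0}ᶜ from fun x hx => ne_of_gt hx))).and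
    (Ioc_mem_nhdsGT (show (0 : ℝ) < 1 by norm_num))
  obtain ⟨θ, hθ, hθ'⟩ := h2.exists
  refine ⟨θ, hθ', ?_⟩
  rw [slope_def_field, div_neg_iff] at hθ
  have := hθ'.1
  simp at hθ
  rcases hθ with h3 | h3 <;> linarith [h3.1, h3.2]

/-- The matrix with entries p_ij · ratio_ij^θ has a positive vector that it contracts. With φ < 1
the excursion mean, the passage through state 1 takes two steps, hence κ = √φ. The second coordinate
of v gives equality in row 1; in row 0 the loop has slack because κ < 1. -/
theorem exists_subinvariant_vector {p c s : ℝ} (hp : p ∈ Set.Ioo (0 : ℝ) 1) (hc : 0 < c)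
    (hs : 0 < s) (hs1 : s < 1) (h : (p / s) ^ p * ((1 - p) / (c * s ^ 2)) ^ (1 - p) < 1) :
    ∃ θ ∈ Set.Ioc (0 : ℝ) 1, ∃ κ ∈ Set.Ioo (0 : ℝ) 1, ∃ v : Fin 2 → ℝ, (∀ j, 1 ≤ v j) ∧
      ∀ i, ∑ j, transitionMatrix p i j * (stepRatio p c s i j ^ θ * v j) ≤ κ * v i := by
  obtain ⟨θ, hθ, hlt⟩ := exists_rpow_mean_lt_one hp hc hs h
  obtain ⟨hp0, hp1⟩ := hp
  have hq : 0 < 1 - p := by linarith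
  set φ := p * (p / s) ^ θ + (1 - p) * ((1 - p) / (c * s ^ 2)) ^ θ with hφ
  have hφ0 : 0 < φ := by positivity
  have hκ0 : 0 < √φ := Real.sqrt_pos.2 hφ0
  have hκ1 : √φ < 1 := by rw [Real.sqrt_lt' one_pos]; simpa using hlt
  have hκκ : √φ * √φ = φ := Real.mul_self_sqrt hφ0.le
  refine ⟨θ, hθ, √φ, ⟨hκ0, hκ1⟩, ![1, (1 / s) ^ θ / √φ], ?_, ?_⟩
  · intro j
    fin_cases j
    · simp
    · have : 1 ≤ (1 / s) ^ θ := Real.one_le_rpow ((one_le_div hs).2 hs1.le) hθ.1.le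
      simpa using (one_le_div hκ0).2 (hκ1.le.trans this)
  · intro i
    fin_cases i
    · have e : ((1 - p) / (c * s)) ^ θ * (1 / s) ^ θ = ((1 - p) / (c * s ^ 2)) ^ θ := by
        rw [← Real.mul_rpow (by positivity) (by positivity)]
        congr 1
        field_simp
      have e2 : p * (p / s) ^ θ + (1 - p) * (((1 - p) / (c * s)) ^ θ * ((1 / s) ^ θ / √φ)) ≤ √φ := by
        rw [← mul_div_assoc, e, ← mul_div_assoc, ← le_sub_iff_add_le', div_le_iff₀ hκ0]
        have : 0 ≤ p * (p / s) ^ θ := by positivity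
        nlinarith
      simpa [Fin.sum_univ_two, transitionMatrix, stepRatio] using e2
    · have e : √φ * ((1 / s) ^ θ / √φ) = (1 / s) ^ θ := by field_simp
      simp only [Fin.sum_univ_two, transitionMatrix, stepRatio]
      simpa using e.ge

/-- By subinvariance the expectation of Rₙ^θ v(Xₙ) decays like κⁿ, so the sum over n has finite
expectation and is almost surely finite. -/
theorem ae_summable_pathRatio (p : Set.Ioo (0 : ℝ) 1) {c s : ℝ} (hc : 0 < c)
    (hs : 0 < s) (hs1 : s < 1)
    (h : ((p : ℝ) / s) ^ (p : ℝ) * ((1 - (p : ℝ)) / (c * s ^ 2)) ^ (1 - (p : ℝ)) < 1) :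
    ∀ᵐ x ∂chainLaw p, Summable (pathRatio p c s x) := by
  obtain ⟨θ, hθ, κ, hκ, v, hv, hle⟩ := exists_subinvariant_vector p.2 hc hs hs1 h
  have hv0 : ∀ j, 0 ≤ v j := fun j => zero_le_one.trans (hv j)
  have hr0 := stepRatio_nonneg p hc hs
  have hR0 : ∀ x n, 0 ≤ pathRatio p c s x n := fun x n => Finset.prod_nonneg fun i _ => hr0 _ _
  let g : ℕ → (ℕ → Fin 2) → ℝ := fun n x => pathRatio p c s x n ^ θ * v (x n)
  have hg0 : ∀ n x, 0 ≤ g n x := fun n x => mul_nonneg (Real.rpow_nonneg (hR0 x n) _) (hv0 _)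
  have hstep : ∀ n, ∫⁻ x, ENNReal.ofReal (g (n + 1) x) ∂chainLaw p ≤
      ENNReal.ofReal κ * ∫⁻ x, ENNReal.ofReal (g n x) ∂chainLaw p := by
    intro n
    let H : (ℕ → Fin 2) → Fin 2 → ENNReal := fun x j =>
      ENNReal.ofReal (pathRatio p c s x n ^ θ * (stepRatio p c s (x n) j ^ θ * v j))
    have h1 : ∀ x, ENNReal.ofReal (g (n + 1) x) = H x (x (n + 1)) := by
      intro x
      have h2 : pathRatio p c s x (n + 1) =
          pathRatio p c s x n * stepRatio p c s (x n) (x (n + 1)) := Finset.prod_range_succ _ _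
      simp only [g, H]
      rw [h2, Real.mul_rpow (hR0 x n) (hr0 _ _), mul_assoc]
    simp_rw [h1]
    rw [lintegral_chainLaw_succ p n H, ← lintegral_const_mul' _ _ ENNReal.ofReal_ne_top]
    · refine lintegral_mono fun x => ?_
      simp only [H]
      calc ∑ j, ENNReal.ofReal (transitionMatrix p (x n) j) *
            ENNReal.ofReal (pathRatio p c s x n ^ θ * (stepRatio p c s (x n) j ^ θ * v j))
          = ENNReal.ofReal (pathRatio p c s x n ^ θ *
              ∑ j, transitionMatrix p (x n) j * (stepRatio p c s (x n) j ^ θ * v j)) := by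
            rw [Finset.mul_sum, ENNReal.ofReal_sum_of_nonneg]
            · refine Finset.sum_congr rfl fun j _ => ?_
              rw [← ENNReal.ofReal_mul (transitionMatrix_nonneg p _ _)]
              congr 1
              ring
            · intro j _
              exact mul_nonneg (Real.rpow_nonneg (hR0 x n) _) (mul_nonneg
                (transitionMatrix_nonneg p _ _)
                (mul_nonneg (Real.rpow_nonneg (hr0 _ _) _) (hv0 _)))
        _ ≤ ENNReal.ofReal (pathRatio p c s x n ^ θ * (κ * v (x n))) := by
            refine ENNReal.ofReal_le_ofReal (mul_le_mul_of_nonneg_left (hle _) ?_)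
            exact Real.rpow_nonneg (hR0 x n) _
        _ = ENNReal.ofReal κ * ENNReal.ofReal (g n x) := by
            rw [← ENNReal.ofReal_mul hκ.1.le]
            congr 1
            simp only [g]
            ring
    · intro x y hxy
      ext j
      have : pathRatio p c s x n = pathRatio p c s y n := by
        refine Finset.prod_congr rfl fun i hi => ?_
        have := Finset.mem_range.1 hi
        rw [hxy i (by omega), hxy (i + 1) (by omega)]
      simp only [H, this, hxy n le_rfl]
  have hbase : ∫⁻ x, ENNReal.ofReal (g 0 x) ∂chainLaw p ≤ ENNReal.ofReal (v 0 + v 1) := by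
    refine (lintegral_mono (g := fun _ => ENNReal.ofReal (v 0 + v 1)) fun x => ?_).trans (by simp)
    refine ENNReal.ofReal_le_ofReal ?_
    simp only [g, pathRatio, Finset.prod_range_zero, Real.one_rpow, one_mul]
    generalize x 0 = j
    fin_cases j
    · simpa using hv0 1
    · simpa using hv0 0
  have hgeom : ∀ n, ∫⁻ x, ENNReal.ofReal (g n x) ∂chainLaw p ≤
      ENNReal.ofReal κ ^ n * ENNReal.ofReal (v 0 + v 1) := by
    intro n
    induction n with
    | zero => simpa using hbase
    | succ n ih =>
      refine (hstep n).trans ?_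
      rw [pow_succ', mul_assoc]
      gcongr
  have hpm : ∀ n, Measurable fun x : ℕ → Fin 2 => pathRatio p c s x n := fun n =>
    Finset.measurable_prod _ fun i _ =>
      measurable_two_coordinates (stepRatio p c s) i (i + 1)
  have hgm : ∀ n, Measurable fun x => ENNReal.ofReal (g n x) := fun n =>
    (((hpm n).pow_const θ).mul ((measurable_of_finite v).comp (measurable_pi_apply n))).ennreal_ofReal
  have hsum : ∫⁻ x, ∑' n, ENNReal.ofReal (g n x) ∂chainLaw p ≠ ⊤ := by
    rw [lintegral_tsum fun n => (hgm n).aemeasurable]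
    refine ne_top_of_le_ne_top ?_ (ENNReal.tsum_le_tsum hgeom)
    rw [ENNReal.tsum_mul_right, ENNReal.tsum_geometric]
    refine ENNReal.mul_ne_top (ENNReal.inv_ne_top.2 ?_) ENNReal.ofReal_ne_top
    rw [Ne, tsub_eq_zero_iff_le, not_le]
    simpa using hκ.2
  filter_upwards [ae_lt_top (Measurable.tsum hgm) hsum] with x hx
  have h1 : Summable fun n => g n x := by
    have := ENNReal.summable_toReal hx.ne
    simpa only [ENNReal.toReal_ofReal (hg0 _ x)] using this
  have h2 : ∀ n, pathRatio p c s x n ^ θ ≤ g n x := fun n =>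
    le_mul_of_one_le_right (Real.rpow_nonneg (hR0 x n) _) (hv _)
  -- Eventually g n x < 1, which forces Rₙ ≤ 1; then θ ≤ 1 gives Rₙ ≤ Rₙ^θ ≤ g n x.
  refine h1.of_norm_bounded_eventually_nat ?_
  filter_upwards [h1.tendsto_atTop_zero.eventually_lt_const one_pos] with n hn
  rw [Real.norm_of_nonneg (hR0 x n)]
  refine le_trans ?_ (h2 n)
  have h3 : pathRatio p c s x n ≤ 1 := by
    by_contra hlt
    have := Real.one_lt_rpow (not_le.1 hlt) hθ.1
    linarith [h2 n]
  rcases (hR0 x n).eq_or_lt with h0 | h0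
  · rw [← h0]
    exact Real.rpow_nonneg le_rfl _
  · simpa using Real.rpow_le_rpow_of_exponent_ge h0 h3 hθ.2

/-! ### Differences of paths as sparse power series -/

/-- The coefficients of the series after position `n`, normalized by the power of `c` reached
at the first one. -/
noncomputable def tailCoeff (c : ℝ) (x : ℕ → Fin 2) (n i : ℕ) : ℝ :=
  ((x (n + i) : ℕ) : ℝ) * c ^ (countOnes x (n + i + 1) - (countOnes x n + 1))

theorem countOnes_succ (x : ℕ → Fin 2) (n : ℕ) : countOnes x (n + 1) = countOnes x n + x n :=
  Finset.sum_range_succ _ _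

theorem countOnes_mono (x : ℕ → Fin 2) : Monotone (countOnes x) :=
  monotone_nat_of_le_succ fun n => by rw [countOnes_succ]; omega

theorem isSparse_tailCoeff {c : ℝ} (hc : c ∈ Set.Ioc (0 : ℝ) 1) {x : ℕ → Fin 2}
    (hx : ∀ n, ¬ (x n = 1 ∧ x (n + 1) = 1)) (n : ℕ) : IsSparse (tailCoeff c x n) := by
  have h0 : ∀ i, 0 ≤ tailCoeff c x n i := fun i =>
    mul_nonneg (Nat.cast_nonneg _) (pow_nonneg hc.1.le _)
  have h1 : ∀ i, tailCoeff c x n i ≤ 1 := fun i =>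
    mul_le_one₀ (by have := (x (n + i)).isLt; exact_mod_cast (by omega : (x (n + i) : ℕ) ≤ 1))
      (pow_nonneg hc.1.le _) (pow_le_one₀ hc.1.le hc.2)
  refine ⟨h0, fun i => ?_⟩
  have h2 : x (n + i) = 0 ∨ x (n + i + 1) = 0 := by
    by_contra! h
    exact hx (n + i) ⟨Fin.eq_one_of_ne_zero _ h.1, Fin.eq_one_of_ne_zero _ h.2⟩
  rcases h2 with h2 | h2
  · have : tailCoeff c x n i = 0 := by simp [tailCoeff, h2]
    linarith [h1 (i + 1)]
  · have : tailCoeff c x n (i + 1) = 0 := by simp [tailCoeff, ← add_assoc, h2]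
    linarith [h1 i]

theorem series_term_eq (c β : ℝ) (x : ℕ → Fin 2) (n : ℕ) :
    ((x n : ℕ) : ℝ) * (c * β) ^ countOnes x (n + 1) * β ^ (n + 1 - countOnes x (n + 1)) =
      ((x n : ℕ) : ℝ) * c ^ countOnes x (n + 1) * β ^ (n + 1) := by
  rw [mul_pow, mul_assoc, mul_assoc, mul_assoc, ← pow_add,
    Nat.add_sub_cancel' (countOnes_le x (n + 1))]

theorem series_term_add_eq (c β : ℝ) (x : ℕ → Fin 2) (n i : ℕ) :
    ((x (n + i) : ℕ) : ℝ) * c ^ countOnes x (n + i + 1) * β ^ (n + i + 1) =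
      c ^ (countOnes x n + 1) * β ^ (n + 1) * (tailCoeff c x n i * β ^ i) := by
  rw [tailCoeff]
  by_cases h : x (n + i) = 0
  · simp [h]
  -- The subtraction in the exponent truncates only when no one has occurred from n on, and then the
  -- coefficient vanishes anyway.
  · have h1 : countOnes x n + 1 ≤ countOnes x (n + i + 1) := by
      rw [countOnes_succ, Fin.eq_one_of_ne_zero _ h]
      have := countOnes_mono x (Nat.le_add_right n i)
      simpa using this
    have h2 : c ^ countOnes x (n + i + 1) = c ^ (countOnes x n + 1) *
        c ^ (countOnes x (n + i + 1) - (countOnes x n + 1)) := by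
      rw [← pow_add, Nat.add_sub_cancel' h1]
    rw [h2]
    ring

theorem countOnes_congr {x y : ℕ → Fin 2} {n : ℕ} (h : ∀ i < n, x i = y i) {m : ℕ} (hm : m ≤ n) :
    countOnes x m = countOnes y m :=
  Finset.sum_congr rfl fun i hi => by rw [h i ((Finset.mem_range.1 hi).trans_le hm)]

/-- Agreement before n gives both paths the same count there, so one common factor normalizes both
tails. -/
theorem series_sub_series {c : ℝ} (hc : c ∈ Set.Ioc (0 : ℝ) 1) {x y : ℕ → Fin 2} {n : ℕ}
    (h : ∀ i < n, x i = y i) {β : ℝ} (hβ : β ∈ Set.Ioo (0 : ℝ) 1) :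
    series β (c * β) x - series β (c * β) y = c ^ (countOnes x n + 1) * β ^ (n + 1) *
      ∑' i, (tailCoeff c x n i - tailCoeff c y n i) * β ^ i := by
  have hcβ : c * β ∈ Set.Ioo (0 : ℝ) 1 :=
    ⟨mul_pos hc.1 hβ.1, (mul_le_of_le_one_left hβ.1.le hc.2).trans_lt hβ.2⟩
  have hs := (summable_series hβ hcβ x).sub (summable_series hβ hcβ y)
  rw [series, series, ← (summable_series hβ hcβ x).tsum_sub (summable_series hβ hcβ y),
    ← hs.sum_add_tsum_nat_add n, Finset.sum_eq_zero, zero_add, ← tsum_mul_left]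
  · refine tsum_congr fun i => ?_
    rw [series_term_eq, series_term_eq, add_comm i n, series_term_add_eq, series_term_add_eq,
      countOnes_congr h le_rfl]
    ring
  · intro i hi
    have hi := Finset.mem_range.1 hi
    rw [h i hi, countOnes_congr h hi, sub_self]

/-- Transversality for two paths that first differ at position `n`. -/
theorem volume_series_sub_le {c : ℝ} (hc : c ∈ Set.Ioc (0 : ℝ) 1) {x y : ℕ → Fin 2}
    (hx : ∀ n, ¬ (x n = 1 ∧ x (n + 1) = 1)) (hy : ∀ n, ¬ (y n = 1 ∧ y (n + 1) = 1)) {n : ℕ}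
    (h : ∀ i < n, x i = y i) (hne : x n ≠ y n) {s : ℝ} (hs : 0 < s) (r : ℝ) :
    volume {β ∈ Set.Icc s 0.739 | |series β (c * β) x - series β (c * β) y| ≤ r} ≤
      ENNReal.ofReal (500 * (s ^ 5)⁻¹ * (r / (c ^ (countOnes x n + 1) * s ^ (n + 1)))) := by
  wlog hxy : x n = 1 generalizing x y
  · have := this hy hx (fun i hi => (h i hi).symm) hne.symm (by omega)
    simp_rw [abs_sub_comm (series _ _ y)] at this
    rwa [countOnes_congr h le_rfl]
  have hyn : y n = 0 := by omega
  have hu0 : tailCoeff c x n 0 = 1 := by simp [tailCoeff, hxy, countOnes_succ]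
  have hw0 : tailCoeff c y n 0 = 0 := by simp [tailCoeff, hyn]
  refine (measure_mono ?_).trans (volume_sparse_sub_le (isSparse_tailCoeff hc hx n)
    (isSparse_tailCoeff hc hy n) hu0 hw0 hs _)
  rintro β ⟨hβ, hr⟩
  refine ⟨hβ, ?_⟩
  have hβ0 : 0 < β := hs.trans_le hβ.1
  have hc0 := hc.1
  rw [series_sub_series hc h ⟨hβ0, by linarith [hβ.2]⟩, abs_mul, abs_of_pos (by positivity)] at hr
  rw [le_div_iff₀ (by positivity), mul_comm]
  refine le_trans ?_ hr
  gcongr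
  exact hβ.1

/-! ### Averaged masses of balls -/

/-- The ratios start with the step from x 0 to x 1, so the contraction c^(x 0) s of the first entry
is left over. -/
theorem pathProb_eq_pathRatio_mul {p c s : ℝ} (hc : 0 < c) (hs : 0 < s) (x : ℕ → Fin 2) (n : ℕ) :
    pathProb p x n * (c ^ (x 0 : ℕ) * s) =
      pathRatio p c s x n * (c ^ countOnes x (n + 1) * s ^ (n + 1)) := by
  induction n with
  | zero => simp [pathProb, pathRatio, countOnes]
  | succ n ih =>
    have h1 : pathProb p x (n + 1) = pathProb p x n * transitionMatrix p (x n) (x (n + 1)) :=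
      Finset.prod_range_succ _ _
    have h2 : pathRatio p c s x (n + 1) =
        pathRatio p c s x n * stepRatio p c s (x n) (x (n + 1)) := Finset.prod_range_succ _ _
    have h3 : transitionMatrix p (x n) (x (n + 1)) =
        stepRatio p c s (x n) (x (n + 1)) * (c ^ (x (n + 1) : ℕ) * s) := by
      rw [stepRatio, div_mul_cancel₀]
      positivity
    rw [h1, h2, countOnes_succ x (n + 1), h3, pow_add, pow_succ s (n + 1)]
    linear_combination stepRatio p c s (x n) (x (n + 1)) * (c ^ (x (n + 1) : ℕ) * s) * ih

theorem pathProb_div_le {p : Set.Ioo (0 : ℝ) 1} {c s : ℝ} (hc : c ∈ Set.Ioc (0 : ℝ) 1)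
    (hs : 0 < s) (x : ℕ → Fin 2) (n : ℕ) :
    pathProb p x n / (c ^ (countOnes x (n + 1) + 1) * s ^ (n + 1 + 1)) ≤
      pathRatio p c s x n / (c * s) ^ 2 := by
  have hc0 := hc.1
  have hR0 : 0 ≤ pathRatio p c s x n := Finset.prod_nonneg fun i _ => stepRatio_nonneg p hc.1 hs _ _
  have h1 : pathProb p x n =
      pathRatio p c s x n * (c ^ countOnes x (n + 1) * s ^ (n + 1)) / (c ^ (x 0 : ℕ) * s) := by
    rw [eq_div_iff (by positivity), pathProb_eq_pathRatio_mul hc.1 hs]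
  have h2 : pathProb p x n / (c ^ (countOnes x (n + 1) + 1) * s ^ (n + 1 + 1)) =
      pathRatio p c s x n / (c ^ ((x 0 : ℕ) + 1) * s ^ 2) := by
    rw [h1]
    field_simp
    ring
  rw [h2, mul_pow]
  have h3 : c ^ 2 ≤ c ^ ((x 0 : ℕ) + 1) :=
    pow_le_pow_of_le_one hc.1.le hc.2 (by have := (x 0).isLt; omega)
  gcongr

theorem measurable_series_uncurry (c : ℝ) :
    Measurable fun z : ℝ × (ℕ → Fin 2) => series z.1 (c * z.1) z.2 := by
  have hcoord : ∀ n, Measurable fun z : ℝ × (ℕ → Fin 2) => z.2 n := fun n =>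
    (measurable_pi_apply n).comp measurable_snd
  have hcount : ∀ i, Measurable fun z : ℝ × (ℕ → Fin 2) => countOnes z.2 i := fun i =>
    Finset.measurable_sum _ fun k _ =>
      (measurable_of_finite fun j : Fin 2 => (j : ℕ)).comp (hcoord k)
  refine Measurable.tsum fun n => Measurable.mul (Measurable.mul ?_ ?_) ?_
  · exact (measurable_of_finite fun j : Fin 2 => ((j : ℕ) : ℝ)).comp (hcoord n)
  · exact (measurable_fst.const_mul c).pow (hcount (n + 1))
  · exact measurable_fst.pow ((measurable_from_nat (f := fun m => n + 1 - m)).comp (hcount (n + 1)))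

theorem measurableSet_series_close (c r : ℝ) : MeasurableSet
    {z : (ℝ × (ℕ → Fin 2)) × (ℕ → Fin 2) |
      |series z.1.1 (c * z.1.1) z.1.2 - series z.1.1 (c * z.1.1) z.2| ≤ r} := by
  refine measurableSet_le (Measurable.abs (Measurable.sub ?_ ?_)) measurable_const
  · exact (measurable_series_uncurry c).comp measurable_fst
  · exact (measurable_series_uncurry c).comp
      ((measurable_fst.comp measurable_fst).prodMk measurable_snd)

/-- Cylinder probabilities are at most a constant times Rₙ, which tends to zero. Thus almost every
second path differs from x somewhere. -/
theorem chainLaw_singleton {p : Set.Ioo (0 : ℝ) 1} {c s : ℝ} (hc : c ∈ Set.Ioc (0 : ℝ) 1)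
    (hs : s ∈ Set.Ioo (0 : ℝ) 1) {x : ℕ → Fin 2} (hsum : Summable (pathRatio p c s x)) :
    chainLaw p {x} = 0 := by
  have hc0 := hc.1
  have hs0 := hs.1
  have h1 : ∀ n, chainLaw p {x} ≤ ENNReal.ofReal (pathRatio p c s x n / (c * s) ^ 2) := by
    intro n
    refine (measure_mono (t := {y | ∀ i ≤ n, y i = x i}) ?_).trans
      ((chainLaw_cylinder_le p x n).trans (ENNReal.ofReal_le_ofReal ?_))
    · rintro y rfl i -
      rfl
    · refine le_trans ?_ (pathProb_div_le hc hs0 x n)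
      refine le_div_self (Finset.prod_nonneg fun i _ => transitionMatrix_nonneg p _ _)
        (by positivity) (mul_le_one₀ (pow_le_one₀ hc.1.le hc.2) (by positivity)
          (pow_le_one₀ hs.1.le hs.2.le))
  have h2 : Filter.Tendsto (fun n => ENNReal.ofReal (pathRatio p c s x n / (c * s) ^ 2))
      Filter.atTop (nhds 0) := by
    have := ENNReal.tendsto_ofReal ((hsum.tendsto_atTop_zero).div_const ((c * s) ^ 2))
    simpa using this
  exact le_antisymm (ge_of_tendsto' h2 h1) zero_le

/-- The averaged mass of balls is at most a constant times the radius. -/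
theorem exists_lintegral_close_le {p : Set.Ioo (0 : ℝ) 1} {c s : ℝ} (hc : c ∈ Set.Ioc (0 : ℝ) 1)
    (hs : s ∈ Set.Ioo (0 : ℝ) 1) {x : ℕ → Fin 2} (hx : ∀ n, ¬ (x n = 1 ∧ x (n + 1) = 1))
    (hsum : Summable (pathRatio p c s x)) :
    ∃ K : ENNReal, K ≠ ⊤ ∧ ∀ r : ℝ, 0 < r →
      ∫⁻ β in Set.Icc s 0.739,
        chainLaw p {y | |series β (c * β) x - series β (c * β) y| ≤ r} ≤ ENNReal.ofReal r * K := by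
  have hc0 := hc.1
  have hs0 := hs.1
  have hR0 : ∀ n, 0 ≤ pathRatio p c s x n := fun n =>
    Finset.prod_nonneg fun i _ => stepRatio_nonneg p hc.1 hs0 _ _
  let A := 500 * (s ^ 5)⁻¹
  let B : ℕ → ℝ := fun n => A * (1 / (c ^ (countOnes x n + 1) * s ^ (n + 1)))
  let D : ℕ → Set (ℕ → Fin 2) := fun n => {y | ∀ i < n, y i = x i}
  have hD : ∀ n, MeasurableSet (D n) := fun n => by
    have : D n = ⋂ i ∈ Set.Iio n, {y | y i = x i} := by
      ext; simp [D]
    rw [this]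
    exact MeasurableSet.biInter (Set.to_countable _) fun i _ =>
      measurableSet_eq_fun (measurable_pi_apply i) measurable_const
  have hBD : ∀ n, ENNReal.ofReal (B (n + 1)) * chainLaw p (D (n + 1)) ≤
      ENNReal.ofReal (A * (pathRatio p c s x n / (c * s) ^ 2)) := by
    intro n
    have h1 : chainLaw p (D (n + 1)) ≤ ENNReal.ofReal (pathProb p x n) := by
      refine le_of_eq_of_le ?_ (chainLaw_cylinder_le p x n)
      congr 1
      ext y
      simp [D]
    calc _ ≤ ENNReal.ofReal (B (n + 1)) * ENNReal.ofReal (pathProb p x n) := by gcongr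
      _ = ENNReal.ofReal (B (n + 1) * pathProb p x n) := (ENNReal.ofReal_mul (by positivity)).symm
      _ ≤ _ := by
        refine ENNReal.ofReal_le_ofReal ?_
        have : B (n + 1) * pathProb p x n =
            A * (pathProb p x n / (c ^ (countOnes x (n + 1) + 1) * s ^ (n + 1 + 1))) := by
          simp only [B]
          ring
        rw [this]
        exact mul_le_mul_of_nonneg_left (pathProb_div_le hc hs0 x n) (by positivity)
  refine ⟨∑' n, ENNReal.ofReal (B n) * chainLaw p (D n), ?_, fun r hr => ?_⟩
  -- D 0 imposes no condition and is split off; D (n + 1) fixes the coordinates 0, …, n, which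
  -- matches `pathProb p x n`.
  · rw [tsum_eq_zero_add' ENNReal.summable]
    refine ENNReal.add_ne_top.2
      ⟨ENNReal.mul_ne_top ENNReal.ofReal_ne_top (measure_ne_top _ _), ?_⟩
    refine ne_top_of_le_ne_top ?_ (ENNReal.tsum_le_tsum hBD)
    rw [← ENNReal.ofReal_tsum_of_nonneg]
    · exact ENNReal.ofReal_ne_top
    · exact fun n => mul_nonneg (by positivity) (div_nonneg (hR0 n) (by positivity))
    · exact (hsum.div_const _).mul_left _
  · have hE : MeasurableSet {z : ℝ × (ℕ → Fin 2) |
        |series z.1 (c * z.1) x - series z.1 (c * z.1) z.2| ≤ r} :=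
      ((measurable_fst.prodMk measurable_const).prodMk measurable_snd) (measurableSet_series_close c r)
    have hswap : ∫⁻ β in Set.Icc s 0.739,
        chainLaw p {y | |series β (c * β) x - series β (c * β) y| ≤ r} =
        ∫⁻ y, volume {β ∈ Set.Icc s 0.739 | |series β (c * β) x - series β (c * β) y| ≤ r}
          ∂chainLaw p := by
      have h1 := Measure.prod_apply (μ := volume.restrict (Set.Icc s 0.739)) (ν := chainLaw p) hE
      have h2 := Measure.prod_apply_symm (μ := volume.restrict (Set.Icc s 0.739))
        (ν := chainLaw p) hE
      refine h1.symm.trans (h2.trans (lintegral_congr fun y => ?_))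
      rw [Measure.restrict_apply' measurableSet_Icc, Set.inter_comm]
      rfl
    rw [hswap]
    calc _ ≤ ∫⁻ y, ∑' n, ENNReal.ofReal r * ENNReal.ofReal (B n) * (D n).indicator 1 y
          ∂chainLaw p := by
          refine lintegral_mono_ae ?_
          have hne : ∀ᵐ y ∂chainLaw p, y ≠ x := by
            rw [ae_iff]
            simpa using chainLaw_singleton hc hs hsum
          filter_upwards [ae_chainLaw_not_adjacent_ones p, hne] with y hy hyx
          have hex : ∃ n, x n ≠ y n := by
            by_contra! h
            exact hyx (funext fun n => (h n).symm)
          classical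
          have hlt : ∀ i < Nat.find hex, x i = y i := fun i hi => not_not.1 (Nat.find_min hex hi)
          refine (volume_series_sub_le hc hx hy hlt (Nat.find_spec hex) hs0 r).trans ?_
          -- The single term at the first index of disagreement already dominates; the full sum
          -- avoids partitioning the paths by that index.
          refine le_trans ?_ (ENNReal.le_tsum (Nat.find hex))
          rw [Set.indicator_of_mem (show y ∈ D (Nat.find hex) from fun i hi => (hlt i hi).symm),
            Pi.one_apply, mul_one, ← ENNReal.ofReal_mul hr.le]
          refine ENNReal.ofReal_le_ofReal (le_of_eq ?_)
          simp only [B, A]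
          ring
      _ = ENNReal.ofReal r * ∑' n, ENNReal.ofReal (B n) * chainLaw p (D n) := by
          rw [lintegral_tsum fun n =>
            ((measurable_one.indicator (hD n)).const_mul _).aemeasurable, ← ENNReal.tsum_mul_left]
          refine tsum_congr fun n => ?_
          rw [lintegral_const_mul' _ _ (by finiteness), lintegral_indicator_one (hD n), mul_assoc]

/-! ### Lower densities and absolute continuity -/

/-- A finite measure on the line whose lower density is finite almost everywhere is absolutely
continuous. -/
theorem absolutelyContinuous_of_liminf_lt_top (μ : Measure ℝ) [IsFiniteMeasure μ] {r : ℕ → ℝ}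
    (hr : ∀ k, 0 < r k) (hr0 : Filter.Tendsto r Filter.atTop (nhds 0))
    (h : ∀ᵐ z ∂μ, Filter.liminf (fun k => μ (Metric.closedBall z (r k)) / ENNReal.ofReal (r k))
      Filter.atTop < ⊤) : μ ≪ volume := by
  intro A hA
  let E : ℕ → Set ℝ := fun M => {z ∈ A | ∃ᶠ k in Filter.atTop,
    μ (Metric.closedBall z (r k)) ≤ ((M : NNReal) • volume : Measure ℝ) (Metric.closedBall z (r k))}
  have hE : ∀ M, μ (E M) = 0 := by
    intro M
    have hr1 : Filter.Tendsto r Filter.atTop (nhdsWithin 0 (Set.Ioi 0)) :=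
      tendsto_nhdsWithin_iff.2 ⟨hr0, Filter.Eventually.of_forall hr⟩
    -- On E M the bound μ ≤ M · volume holds on arbitrarily small balls about each point;
    -- Besicovitch covering transfers it to E M, which is Lebesgue null as a subset of A.
    have h1 := (Besicovitch.vitaliFamily μ).measure_le_of_frequently_le ((M : NNReal) • volume)
      Measure.AbsolutelyContinuous.rfl (E M) fun z hz =>
        ((Besicovitch.tendsto_filterAt μ z).comp hr1).frequently hz.2
    refine le_antisymm (h1.trans ?_) zero_le
    rw [Measure.smul_apply, measure_mono_null (fun z hz => hz.1) hA, smul_zero]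
  refine measure_mono_null (t := {z | ¬ Filter.liminf (fun k => μ (Metric.closedBall z (r k)) /
    ENNReal.ofReal (r k)) Filter.atTop < ⊤} ∪ ⋃ M, E M) ?_
    (measure_union_null h (measure_iUnion_null hE))
  intro z hz
  by_cases hlim : Filter.liminf (fun k => μ (Metric.closedBall z (r k)) / ENNReal.ofReal (r k))
      Filter.atTop < ⊤
  · refine Or.inr (Set.mem_iUnion.2 ?_)
    obtain ⟨M, hM⟩ := ENNReal.exists_nat_gt hlim.ne
    refine ⟨M, hz, (Filter.frequently_lt_of_liminf_lt (by isBoundedDefault) hM).mono fun k hk => ?_⟩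
    have hk' := (ENNReal.div_le_iff (ENNReal.ofReal_pos.2 (hr k)).ne' ENNReal.ofReal_ne_top).1 hk.le
    refine hk'.trans ?_
    rw [Measure.smul_apply, Real.volume_closedBall, ENNReal.smul_def, smul_eq_mul]
    gcongr
    · simp
    · linarith [hr k]
  · exact Or.inl hlim

theorem measurable_measure_abs_sub_le {Ω : Type*} [MeasurableSpace Ω] (P : Measure Ω) [SFinite P]
    {f : Ω → ℝ} (hf : Measurable f) (r : ℝ) : Measurable fun z : ℝ => P {y | |z - f y| ≤ r} := by
  have : MeasurableSet {z : ℝ × Ω | |z.1 - f z.2| ≤ r} :=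
    measurableSet_le (measurable_fst.sub (hf.comp measurable_snd)).abs measurable_const
  exact measurable_measure_prodMk_left this

theorem ae_absolutelyContinuous_of_lt {p : Set.Ioo (0 : ℝ) 1} {c s : ℝ}
    (hc : c ∈ Set.Ioc (0 : ℝ) 1) (hs : s ∈ Set.Ioo (0 : ℝ) 1)
    (h : ((p : ℝ) / s) ^ (p : ℝ) * ((1 - (p : ℝ)) / (c * s ^ 2)) ^ (1 - (p : ℝ)) < 1) :
    ∀ᵐ β : ℝ, β ∈ Set.Icc s 0.739 → markovGeometricMeasure β (c * β) p ≪ volume := by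
  let r : ℕ → ℝ := fun k => 1 / ((k : ℝ) + 1)
  have hr : ∀ k, 0 < r k := fun k => Nat.one_div_pos_of_nat
  have hr0 : Filter.Tendsto r Filter.atTop (nhds 0) := tendsto_one_div_add_atTop_nhds_zero_nat
  let φ : ℕ → ℝ × (ℕ → Fin 2) → ENNReal := fun k z =>
    chainLaw p {y | |series z.1 (c * z.1) z.2 - series z.1 (c * z.1) y| ≤ r k} /
      ENNReal.ofReal (r k)
  have hφ : ∀ k, Measurable (φ k) := fun k =>
    (measurable_measure_prodMk_left (ν := chainLaw p) (measurableSet_series_close c (r k))).div_const _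
  have hG : MeasurableSet {z | Filter.liminf (fun k => φ k z) Filter.atTop < ⊤} :=
    measurableSet_lt (Measurable.liminf hφ) measurable_const
  have hx : ∀ᵐ x ∂chainLaw p, ∀ᵐ β ∂volume.restrict (Set.Icc s 0.739),
      Filter.liminf (fun k => φ k (β, x)) Filter.atTop < ⊤ := by
    filter_upwards [ae_chainLaw_not_adjacent_ones p, ae_summable_pathRatio p hc.1 hs.1 hs.2 h]
      with x hx hsum
    obtain ⟨K, hK, hle⟩ := exists_lintegral_close_le hc hs hx hsum
    have hφx : ∀ k, Measurable fun β => φ k (β, x) := fun k =>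
      (hφ k).comp (measurable_id.prodMk measurable_const)
    refine ae_lt_top (Measurable.liminf hφx) (ne_top_of_le_ne_top hK ?_)
    -- Fatou's lemma: the bound K, uniform in the radius, passes to the lower density.
    refine (lintegral_liminf_le hφx).trans ?_
    refine (Filter.liminf_le_liminf (v := fun _ => K) (Filter.Eventually.of_forall fun k => ?_)).trans
      (by simp)
    simp only [φ, div_eq_mul_inv]
    rw [lintegral_mul_const' _ _ (ENNReal.inv_ne_top.2 (ENNReal.ofReal_pos.2 (hr k)).ne'),
      ← div_eq_mul_inv]
    refine ENNReal.div_le_of_le_mul ?_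
    rw [mul_comm]
    exact hle (r k) (hr k)
  have hβ := (Measure.ae_ae_comm (μ := volume.restrict (Set.Icc s 0.739)) (ν := chainLaw p)
    (p := fun β x => Filter.liminf (fun k => φ k (β, x)) Filter.atTop < ⊤) hG).2 hx
  rw [← ae_restrict_iff' measurableSet_Icc]
  filter_upwards [hβ] with β hβ
  have hm : ∀ k, Measurable fun z : ℝ => chainLaw p {y | |z - series β (c * β) y| ≤ r k} :=
    fun k => measurable_measure_abs_sub_le (chainLaw p) (measurable_series β (c * β)) (r k)
  refine absolutelyContinuous_of_liminf_lt_top _ hr hr0 ?_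
  have hball : ∀ z k, markovGeometricMeasure β (c * β) p (Metric.closedBall z (r k)) =
      chainLaw p {y | |z - series β (c * β) y| ≤ r k} := by
    intro z k
    rw [markovGeometricMeasure, Measure.map_apply (measurable_series _ _) measurableSet_closedBall]
    congr 1
    ext y
    simp [Real.dist_eq, abs_sub_comm]
  simp_rw [hball]
  rw [markovGeometricMeasure, ae_map_iff (measurable_series _ _).aemeasurable]
  · exact hβ
  · exact measurableSet_lt (Measurable.liminf fun k => (hm k).div_const _) measurable_const

/-- The exceptional null set depends on s, so s is taken from a countable set; continuity in the
parameter leaves room just below β. -/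
theorem exists_rat_lt_of_lt_one {p c β : ℝ} (hp : p ∈ Set.Ioo (0 : ℝ) 1) (hc : 0 < c) (hβ : 0 < β)
    (h : (p / β) ^ p * ((1 - p) / (c * β ^ 2)) ^ (1 - p) < 1) :
    ∃ s : ℚ, 0 < (s : ℝ) ∧ (s : ℝ) < β ∧
      (p / (s : ℝ)) ^ p * ((1 - p) / (c * (s : ℝ) ^ 2)) ^ (1 - p) < 1 := by
  have hcont : ContinuousAt (fun t : ℝ => (p / t) ^ p * ((1 - p) / (c * t ^ 2)) ^ (1 - p)) β := by
    refine ContinuousAt.mul (ContinuousAt.rpow_const ?_ (Or.inr hp.1.le))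
      (ContinuousAt.rpow_const ?_ (Or.inr (by linarith [hp.2])))
    · exact continuousAt_const.div continuousAt_id hβ.ne'
    · exact continuousAt_const.div (by fun_prop) (by positivity)
  obtain ⟨l, hl, hlβ⟩ := exists_Ioc_subset_of_mem_nhds (hcont.eventually_lt_const h) ⟨0, hβ⟩
  obtain ⟨q, hq1, hq2⟩ := exists_rat_btwn (max_lt hl hβ)
  exact ⟨q, (le_max_right _ _).trans_lt hq1, hq2, hlβ ⟨(le_max_left _ _).trans_lt hq1, hq2.le⟩⟩

end MarkovGeometric

theorem mainTheorem5 (p : ℝ) (hp : p ∈ Set.Ioo (0 : ℝ) 1) (c : ℝ) (hc : c ∈ Set.Ioc (0 : ℝ) 1) :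
    ∀ᵐ β : ℝ ∂volume, β ∈ Set.Ioo (0 : ℝ) 0.739 →
      (p / β) ^ p * ((1 - p) / (c * β ^ 2)) ^ (1 - p) < 1 →
        MarkovGeometric.markovGeometricMeasure β (c * β) ⟨p, hp⟩ ≪ volume := by
  have key : ∀ᵐ β : ℝ ∂volume, ∀ s : ℚ, (s : ℝ) ∈ Set.Ioo (0 : ℝ) 1 →
      (p / (s : ℝ)) ^ p * ((1 - p) / (c * (s : ℝ) ^ 2)) ^ (1 - p) < 1 →
      β ∈ Set.Icc (s : ℝ) 0.739 →
        MarkovGeometric.markovGeometricMeasure β (c * β) ⟨p, hp⟩ ≪ volume := by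
    refine ae_all_iff.2 fun s => ?_
    by_cases hs : (s : ℝ) ∈ Set.Ioo (0 : ℝ) 1
    · by_cases h : (p / (s : ℝ)) ^ p * ((1 - p) / (c * (s : ℝ) ^ 2)) ^ (1 - p) < 1
      · filter_upwards [MarkovGeometric.ae_absolutelyContinuous_of_lt (p := ⟨p, hp⟩) hc hs h]
          with β hβ _ _ using hβ
      · exact Filter.Eventually.of_forall fun _ _ h' => absurd h' h
    · exact Filter.Eventually.of_forall fun _ h' => absurd h' hs
  filter_upwards [key] with β hβ hβ1 h
  obtain ⟨s, hs0, hs1, hlt⟩ := MarkovGeometric.exists_rat_lt_of_lt_one hp hc.1 hβ1.1 h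
  exact hβ s ⟨hs0, by linarith [hβ1.2]⟩ hlt ⟨hs1.le, hβ1.2.le⟩
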